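/- **Theorem (Positional completeness).** *Syntax and semantics.* Formulae of $\mathbf{ATL}$ are given by $\varphi ::= p \mid \neg\varphi \mid \varphi\to\psi \mid \langle\langle A\rangle\rangle\bigcirc\varphi \mid \langle\langle A\rangle\rangle\Box\varphi \mid \langle\langle A\rangle\rangle\varphi\,\mathcal U\,\psi$ ($p$ an atom, $A$ a finite set of agents); $\varphi\wedge\psi$ abbreviates $\neg(\varphi\to\neg\psi)$ and $\top$ abbreviates $p_0\to p_0$ for a fixed atom $p_0$. A concurrent game frame over a finite non-empty agent set $\Sigma$ has a non-empty set of states, for each agent $a$ and state $s$ a number $d_a(s)\ge 1$ of moves, and a transition function sending a state and a move vector to a state. A concurrent game model is such a frame together with the set of atoms true at each state. $\langle\langle A\rangle\rangle\bigcirc\varphi$ holds at $s$ if $A$ has a joint move at $s$ all of whose outcomes satisfy $\varphi$; $\langle\langle A\rangle\rangle\Box\varphi$ and $\langle\langle A\rangle\rangle\varphi\,\mathcal U\,\psi$ hold at $s$ if $A$ has a strategy such that all runs from $s$ compatible with it satisfy $\Box\varphi$, respectively $\varphi\,\mathcal U\,\psi$. The strategies may depend on the whole history (perfect recall) or only on the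 current state (positional). *Decomposition.* The $\alpha$-formulae, with their conjuncts, are $\neg\neg\varphi$ $(\varphi,\varphi)$; $\neg(\varphi\to\psi)$ $(\varphi,\neg\psi)$; $\neg\langle\langle\Sigma\rangle\rangle\bigcirc\varphi$ $(\langle\langle\emptyset\rangle\rangle\bigcirc\neg\varphi$, twice$)$; $\langle\langle A\rangle\rangle\Box\varphi$ $(\varphi,\langle\langle A\rangle\rangle\bigcirc\langle\langle A\rangle\rangle\Box\varphi)$. The $\beta$-formulae, with their disjuncts, are $\varphi\to\psi$ other than $\top$ $(\neg\varphi,\psi)$; $u=\langle\langle A\rangle\rangle\varphi\,\mathcal U\,\psi$ $(\psi,\varphi\wedge\langle\langle A\rangle\rangle\bigcirc u)$; $\neg u$ $(\neg\psi\wedge\neg\varphi,\neg\psi\wedge\neg\langle\langle A\rangle\rangle\bigcirc u)$; $\neg\langle\langle A\rangle\rangle\Box\varphi$ $(\neg\varphi,\neg\langle\langle A\rangle\rangle\bigcirc\langle\langle A\rangle\rangle\Box\varphi)$. A set is downward saturated if it contains both conjuncts of each of its $\alpha$-formulae and a disjunct of each of its $\beta$-formulae. *Tableau.* Let $\theta$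 be a formula and $\Sigma$ a finite non-empty set of agents containing the set $\Sigma_\theta$ of all agents of $\theta$ (the case $\Sigma=\Sigma_\theta$ is tight satisfiability). Starting from the prestate $\{\theta\}$, repeat the following. * Each prestate $\Gamma$ is connected to the states that are the minimal downward saturated extensions of $\Gamma$, where $\langle\langle\Sigma\rangle\rangle\bigcirc\top$ is added to those which contain no formula $\langle\langle A\rangle\rangle\bigcirc\varphi$ or $\neg\langle\langle A\rangle\rangle\bigcirc\varphi$. * For each state $\Delta$ that contains no pair $\chi,\neg\chi$, list its formulae $\langle\langle A_p\rangle\rangle\bigcirc\varphi_p$ ($0\le p<m$), followed by its formulae $\neg\langle\langle A'_q\rangle\rangle\bigcirc\psi_q$ with $A'_q\ne\Sigma$ ($0\le q<l$). For each $\sigma\in D(\Delta)=\{0,\dots,m+l-1\}^{\Sigma}$ let $N(\sigma)=\{a:\sigma_a\ge m\}$ and $\mathbf{neg}(\sigma)=\sum_{a\in N(\sigma)}(\sigma_a-m)\bmod l$. Let $D(\Delta,\langle\langle A_p\rangle\rangle\bigcirc\varphi_p)=\{\sigma:\sigma_a=p\ \forall a\in A_p\}$, $D(\Delta,\neg\langle\langle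 A'_q\rangle\rangle\bigcirc\psi_q)=\{\sigma:\mathbf{neg}(\sigma)=q,\ \Sigma\setminus A'_q\subseteq N(\sigma)\}$, and $D(\Delta,\neg\langle\langle\Sigma\rangle\rangle\bigcirc\psi)=D(\Delta)$. Connect $\Delta$ by $\sigma$ to the prestate consisting of the $\varphi_p$ and the $\neg\psi_q$ for those listed formulae $\chi$ with $\sigma\in D(\Delta,\chi)$, or to $\{\top\}$ if there are none. Then remove the prestates: $\Delta\xrightarrow{\sigma}\Delta'$ if $\sigma$ leads from $\Delta$ to a prestate connected to $\Delta'$. Finally eliminate states one at a time, as long as possible, each time a state $\Delta$ that (E1) contains some $\chi,\neg\chi$; or (E2) for some $\sigma\in D(\Delta)$ has no remaining $\sigma$-successor; or (E3) contains an eventuality ($\xi=\langle\langle A\rangle\rangle\varphi\,\mathcal U\,\psi$ or $\xi=\neg\langle\langle A\rangle\rangle\Box\varphi$) not realized at $\Delta$. Here realization is the least relation such that $\xi$ is realized at a remaining state $\Delta\ni\xi$ if $\psi\in\Delta$ (respectively $\neg\varphi\in\Delta$), or if $\varphi,\langle\langle A\rangle\rangle\bigcirc\xi\in\Delta$ (respectively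 $\neg\langle\langle A\rangle\rangle\bigcirc\langle\langle A\rangle\rangle\Box\varphi\in\Delta$) and for every $\sigma\in D(\Delta,\langle\langle A\rangle\rangle\bigcirc\xi)$ (respectively $\sigma\in D(\Delta,\neg\langle\langle A\rangle\rangle\bigcirc\langle\langle A\rangle\rangle\Box\varphi)$) $\xi$ is realized at some remaining $\sigma$-successor of $\Delta$. The result is the final tableau $\mathcal T^\theta$; it is open if one of its states contains $\theta$. *Claim.* For every choice of the lists and of the order of eliminations: if $\mathcal T^\theta$ is open, then there are a frame over $\Sigma$ with finitely many states, a labelling $H$ of its states by sets of formulae, and a state $s$ with $\theta\in H(s)$ such that 1. $H$ is a positional concurrent game Hintikka structure, i.e. for every state $w$: $H(w)$ is downward saturated and contains no pair $\chi,\neg\chi$; if $\langle\langle A\rangle\rangle\bigcirc\varphi\in H(w)$, then $A$ has a joint move at $w$ with $\varphi\in H(w')$ for all its outcomes $w'$; if $\neg\langle\langle A\rangle\rangle\bigcirc\varphi\in H(w)$, then there is a co-$A$-move at $w$ (a function extending each $A$-move to a move vector) with $\neg\varphi\in H(w')$ for all its outcomes $w'$; if $\langle\langle A\rangle\rangle\varphi\,\mathcal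 U\,\psi\in H(w)$, then $A$ has a positional strategy such that on each compatible run $\lambda$ from $w$ there is $i$ with $\psi\in H(\lambda[i])$ and $\varphi\in H(\lambda[j])$ for all $j<i$; if $\neg\langle\langle A\rangle\rangle\Box\varphi\in H(w)$, then there is a positional co-$A$-strategy such that on each compatible run $\lambda$ from $w$ there is $i$ with $\neg\varphi\in H(\lambda[i])$; 2. in the model in which exactly the atoms in $H(w)$ are true at each state $w$, $\theta$ is true at $s$, both in the positional and in the perfect-recall semantics. In particular, $\theta$ is satisfiable over $\Sigma$ in a finite concurrent game model with positional strategies. -/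

import Mathlib

namespace ATL

/-! ### Syntax -/

/-- Formulae of alternating-time temporal logic over agent names `Ag` and atoms `AP`. -/
inductive Formula (Ag AP : Type) : Type
  | atom (p : AP) : Formula Ag AP
  | neg (φ : Formula Ag AP) : Formula Ag AP
  | imp (φ ψ : Formula Ag AP) : Formula Ag AP
  | next (A : Finset Ag) (φ : Formula Ag AP) : Formula Ag AP
  | box (A : Finset Ag) (φ : Formula Ag AP) : Formula Ag AP
  | untl (A : Finset Ag) (φ ψ : Formula Ag AP) : Formula Ag AP

namespace Formula

variable {Ag AP : Type}

/-- `φ ∧ ψ`, as an abbreviation. -/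
def conj (φ ψ : Formula Ag AP) : Formula Ag AP := neg (imp φ (neg ψ))

/-- `⊤`, as the abbreviation `p → p` for one fixed atom `p`. -/
def top [Inhabited AP] : Formula Ag AP := imp (atom default) (atom default)

/-- The set of agents occurring in a formula. -/
def agents [DecidableEq Ag] : Formula Ag AP → Finset Ag
  | atom _ => ∅
  | neg φ => φ.agents
  | imp φ ψ => φ.agents ∪ ψ.agents
  | next A φ => A ∪ φ.agents
  | box A φ => A ∪ φ.agents
  | untl A φ ψ => A ∪ (φ.agents ∪ ψ.agents)

end Formula

open Formula

/-- `Alpha Sg χ χ₁ χ₂`: over the agent set `Sg`, `χ` is an α-formula with conjuncts `χ₁`, `χ₂`. -/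
inductive Alpha {Ag AP : Type} (Sg : Finset Ag) :
    Formula Ag AP → Formula Ag AP → Formula Ag AP → Prop
  | neg_neg (φ) : Alpha Sg (neg (neg φ)) φ φ
  | neg_imp (φ ψ) : Alpha Sg (neg (imp φ ψ)) φ (neg ψ)
  | neg_next_all (φ) : Alpha Sg (neg (next Sg φ)) (next ∅ (neg φ)) (next ∅ (neg φ))
  | box (A φ) : Alpha Sg (box A φ) φ (next A (box A φ))

/-- `Beta χ χ₁ χ₂`: `χ` is a β-formula with disjuncts `χ₁`, `χ₂`.
The constant `⊤` counts as primitive and is therefore not a β-formula. -/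
inductive Beta {Ag AP : Type} [Inhabited AP] :
    Formula Ag AP → Formula Ag AP → Formula Ag AP → Prop
  | imp (φ ψ) (h : imp φ ψ ≠ top) : Beta (imp φ ψ) (neg φ) ψ
  | untl (A φ ψ) : Beta (untl A φ ψ) ψ (conj φ (next A (untl A φ ψ)))
  | neg_untl (A φ ψ) : Beta (neg (untl A φ ψ)) (conj (neg ψ) (neg φ))
      (conj (neg ψ) (neg (next A (untl A φ ψ))))
  | neg_box (A φ) : Beta (neg (box A φ)) (neg φ) (neg (next A (box A φ)))

/-! ### Concurrent game frames, moves and strategies -/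

/-- A concurrent game frame over the finite, non-empty agent set `Sg`. -/
structure CGF {Ag : Type} (Sg : Finset Ag) where
  agents_nonempty : Sg.Nonempty
  State : Type
  state_nonempty : Nonempty State
  /-- number of moves of an agent at a state -/
  d : Sg → State → ℕ
  d_pos : ∀ a s, 1 ≤ d a s
  /-- transition function -/
  δ : (s : State) → ((a : Sg) → Fin (d a s)) → State

namespace CGF

variable {Ag : Type} {Sg : Finset Ag} (F : CGF Sg)

/-- The move vectors at `s`. -/
abbrev MoveVec (s : F.State) : Type := (a : Sg) → Fin (F.d a s)

/-- The `A`-moves at `s`. -/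
abbrev CoalMove (A : Finset Ag) (s : F.State) : Type := (a : Sg) → (a : Ag) ∈ A → Fin (F.d a s)

variable {F}

/-- The move vector `σ` extends the `A`-move `m`. -/
def Extends {A : Finset Ag} {s : F.State} (m : F.CoalMove A s) (σ : F.MoveVec s) : Prop :=
  ∀ (a : Sg) (h : (a : Ag) ∈ A), σ a = m a h

/-- The outcome of an `A`-move at `s`. -/
def moveOut {A : Finset Ag} (s : F.State) (m : F.CoalMove A s) : Set F.State :=
  {s' | ∃ σ : F.MoveVec s, Extends m σ ∧ F.δ s σ = s'}

variable (F)

/-- The co-`A`-moves at `s`. -/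
def CoMove (A : Finset Ag) (s : F.State) : Type :=
  {c : F.CoalMove A s → F.MoveVec s // ∀ m, Extends m (c m)}

variable {F}

/-- The outcome of a co-`A`-move at `s`. -/
def coMoveOut {A : Finset Ag} (s : F.State) (c : F.CoMove A s) : Set F.State :=
  {s' | ∃ m : F.CoalMove A s, F.δ s (c.1 m) = s'}

variable (F)

/-- An `A`-strategy assigns an `A`-move at `s` to each non-empty sequence of states with last
element `s`; the list argument holds the states before the last one. Under `γ`-recall only
the values on sequences of length at most `γ` are used. -/
def Strategy (A : Finset Ag) : Type := List F.State → (s : F.State) → F.CoalMove A s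

/-- Co-`A`-strategies. -/
def CoStrategy (A : Finset Ag) : Type := List F.State → (s : F.State) → F.CoMove A s

variable {F}

/-- The states of `lam` at the positions `j, …, i - 1`, where `j = max (i - γ + 1) 0`: what is
remembered at position `i`, besides the current state, under `γ`-recall. `γ = 1` is positional
recall (nothing is remembered) and `γ = ⊤` is perfect recall (all earlier states are). -/
def memory (γ : ℕ∞) (lam : ℕ → F.State) (i : ℕ) : List F.State :=
  let j := if γ = ⊤ then 0 else i + 1 - γ.toNat
  (List.range' j (i - j)).map lam

/-- The outcome at `s` of an `A`-strategy used with `γ`-recall: the set of all `s`-runs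
compatible with it. -/
def stratOut (γ : ℕ∞) {A : Finset Ag} (s : F.State) (f : F.Strategy A) : Set (ℕ → F.State) :=
  {lam | lam 0 = s ∧ ∀ i, lam (i + 1) ∈ moveOut (lam i) (f (memory γ lam i) (lam i))}

/-- The outcome at `s` of a co-`A`-strategy used with `γ`-recall. -/
def coStratOut (γ : ℕ∞) {A : Finset Ag} (s : F.State) (f : F.CoStrategy A) :
    Set (ℕ → F.State) :=
  {lam | lam 0 = s ∧ ∀ i, lam (i + 1) ∈ coMoveOut (lam i) (f (memory γ lam i) (lam i))}

end CGF

/-! ### Models and truth -/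

/-- A concurrent game model over the agent set `Sg`. -/
structure CGM {Ag : Type} (Sg : Finset Ag) (AP : Type) extends CGF Sg where
  L : State → Set AP

/-- Truth of a formula at a state of a model, where strategies are `γ`-recall strategies:
`γ = ⊤` is the perfect-recall semantics and `γ = 1` the positional semantics. -/
def CGM.Sat {Ag AP : Type} {Sg : Finset Ag} (M : CGM Sg AP) (γ : ℕ∞) :
    Formula Ag AP → M.State → Prop
  | .atom p, s => p ∈ M.L s
  | .neg φ, s => ¬ M.Sat γ φ s
  | .imp φ ψ, s => M.Sat γ φ s → M.Sat γ ψ s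
  | .next A φ, s => ∃ m : M.toCGF.CoalMove A s, ∀ s' ∈ CGF.moveOut s m, M.Sat γ φ s'
  | .box A φ, s => ∃ f : M.toCGF.Strategy A, ∀ lam ∈ CGF.stratOut γ s f,
      ∀ i, M.Sat γ φ (lam i)
  | .untl A φ ψ, s => ∃ f : M.toCGF.Strategy A, ∀ lam ∈ CGF.stratOut γ s f,
      ∃ i, M.Sat γ ψ (lam i) ∧ ∀ j < i, M.Sat γ φ (lam j)

/-! ### Hintikka structures -/

/-- `H` makes the frame `F` a concurrent game Hintikka structure with `γ`-recall strategies
(`γ = 1`: a positional one). -/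
structure IsHintikka {Ag AP : Type} [Inhabited AP] {Sg : Finset Ag} (γ : ℕ∞) (F : CGF Sg)
    (H : F.State → Set (Formula Ag AP)) : Prop where
  H1 : ∀ s φ, neg φ ∈ H s → φ ∉ H s
  H2 : ∀ s χ χ₁ χ₂, Alpha Sg χ χ₁ χ₂ → χ ∈ H s → χ₁ ∈ H s ∧ χ₂ ∈ H s
  H3 : ∀ s χ χ₁ χ₂, Beta χ χ₁ χ₂ → χ ∈ H s → χ₁ ∈ H s ∨ χ₂ ∈ H s
  H4 : ∀ s A φ, next A φ ∈ H s →
    ∃ m : F.CoalMove A s, ∀ s' ∈ CGF.moveOut s m, φ ∈ H s'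
  H5 : ∀ s A φ, neg (next A φ) ∈ H s →
    ∃ c : F.CoMove A s, ∀ s' ∈ CGF.coMoveOut s c, neg φ ∈ H s'
  H6 : ∀ s A φ ψ, untl A φ ψ ∈ H s →
    ∃ f : F.Strategy A, ∀ lam ∈ CGF.stratOut γ s f,
      ∃ i, ψ ∈ H (lam i) ∧ ∀ j < i, φ ∈ H (lam j)
  H7 : ∀ s A φ, neg (box A φ) ∈ H s →
    ∃ f : F.CoStrategy A, ∀ lam ∈ CGF.coStratOut γ s f, ∃ i, neg φ ∈ H (lam i)

/-- The model obtained from a labelled frame by letting exactly the atoms in the label of a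
state be true there. -/
def CGF.expand {Ag AP : Type} {Sg : Finset Ag} (F : CGF Sg)
    (H : F.State → Set (Formula Ag AP)) : CGM Sg AP :=
  { F with L := fun s => {p | atom p ∈ H s} }

/-! ### The tableau: construction phase -/

section Tableau

variable {Ag AP : Type} [Inhabited AP]

/-- Downward saturated sets. -/
def DownwardSaturated (Sg : Finset Ag) (Δ : Set (Formula Ag AP)) : Prop :=
  (∀ χ χ₁ χ₂, Alpha Sg χ χ₁ χ₂ → χ ∈ Δ → χ₁ ∈ Δ ∧ χ₂ ∈ Δ) ∧
  (∀ χ χ₁ χ₂, Beta χ χ₁ χ₂ → χ ∈ Δ → χ₁ ∈ Δ ∨ χ₂ ∈ Δ)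

/-- `Δ` is a minimal downward saturated extension of `Γ`. -/
def IsMinimalExtension (Sg : Finset Ag) (Γ Δ : Set (Formula Ag AP)) : Prop :=
  Γ ⊆ Δ ∧ DownwardSaturated Sg Δ ∧
    ¬ ∃ Δ' : Set (Formula Ag AP), DownwardSaturated Sg Δ' ∧ Γ ⊆ Δ' ∧ Δ' ⊂ Δ

/-- `Δ` contains a formula of the form `⟨⟨A⟩⟩○φ` or `¬⟨⟨A⟩⟩○φ`. -/
def HasNext (Δ : Set (Formula Ag AP)) : Prop :=
  ∃ A φ, next A φ ∈ Δ ∨ neg (next A φ) ∈ Δ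

/-- The rule **SR**, `Γ ⟹ Δ`: the state `Δ` is one of those that the prestate `Γ` is unwound
into. -/
def Unwinds (Sg : Finset Ag) (Γ Δ : Set (Formula Ag AP)) : Prop :=
  ∃ Δ₀, IsMinimalExtension Sg Γ Δ₀ ∧
    ((HasNext Δ₀ ∧ Δ = Δ₀) ∨ (¬ HasNext Δ₀ ∧ Δ = insert (next Sg top) Δ₀))

/-- `Δ` contains a pair `χ`, `¬χ`. -/
def PatentlyInconsistent (Δ : Set (Formula Ag AP)) : Prop :=
  ∃ χ, χ ∈ Δ ∧ neg χ ∈ Δ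

/-- A choice, for every finite set of formulae `Δ`, of a linear order on its next-time formulae
in which the positive ones `⟨⟨A⟩⟩○φ` come before the proper negative ones `¬⟨⟨A⟩⟩○ψ`,
`A ≠ Sg`: `pos Δ` and `neg Δ` list the two kinds. -/
structure NextOrder (Sg : Finset Ag) (AP : Type) where
  pos : Set (Formula Ag AP) → List (Formula Ag AP)
  neg : Set (Formula Ag AP) → List (Formula Ag AP)
  pos_nodup : ∀ Δ, Δ.Finite → (pos Δ).Nodup
  neg_nodup : ∀ Δ, Δ.Finite → (neg Δ).Nodup
  mem_pos : ∀ Δ, Δ.Finite → ∀ χ, χ ∈ pos Δ ↔ χ ∈ Δ ∧ ∃ A φ, χ = Formula.next A φ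
  mem_neg : ∀ Δ, Δ.Finite → ∀ χ, χ ∈ neg Δ ↔
    χ ∈ Δ ∧ ∃ A ψ, A ≠ Sg ∧ χ = Formula.neg (Formula.next A ψ)

variable {Sg : Finset Ag}

namespace NextOrder

variable (ord : NextOrder Sg AP)

/-- The list of all next-time formulae of `Δ`. -/
def list (Δ : Set (Formula Ag AP)) : List (Formula Ag AP) := ord.pos Δ ++ ord.neg Δ

/-- `D(Δ)`: the tableau move vectors at `Δ`, tuples of numbers below the length of the list. -/
def D (Δ : Set (Formula Ag AP)) : Set (Sg → ℕ) := {σ | ∀ a, σ a < (ord.list Δ).length}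

/-- `N(σ)`: the agents that vote for a negative formula. -/
def N (Δ : Set (Formula Ag AP)) (σ : Sg → ℕ) : Finset Sg :=
  Finset.univ.filter fun a => (ord.pos Δ).length ≤ σ a

/-- **neg**(σ): the collective negative vote, `∑_{a ∈ N(σ)} (σ_a - m) mod l`, where `m` and `l`
are the numbers of positive and of negative formulae. -/
def negVote (Δ : Set (Formula Ag AP)) (σ : Sg → ℕ) : ℕ :=
  (∑ a ∈ ord.N Δ σ, (σ a - (ord.pos Δ).length)) % (ord.neg Δ).length

/-- `D(Δ, ⟨⟨A⟩⟩○φ)`: every agent in `A` votes for `⟨⟨A⟩⟩○φ`. -/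
def DPos (Δ : Set (Formula Ag AP)) (A : Finset Ag) (φ : Formula Ag AP) : Set (Sg → ℕ) :=
  {σ | σ ∈ ord.D Δ ∧ ∀ a : Sg, (a : Ag) ∈ A → (ord.list Δ)[σ a]? = some (next A φ)}

/-- `D(Δ, ¬⟨⟨A⟩⟩○ψ)`: the collective negative vote selects `¬⟨⟨A⟩⟩○ψ`, and all agents outside `A`
vote negatively. For `A = Sg` the formula is not listed, being an α-formula with conjunct
`⟨⟨∅⟩⟩○¬ψ`; all move vectors belong to the set then. -/
def DNeg (Δ : Set (Formula Ag AP)) (A : Finset Ag) (ψ : Formula Ag AP) : Set (Sg → ℕ) :=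
  {σ | σ ∈ ord.D Δ ∧ (A ≠ Sg →
    (ord.neg Δ)[ord.negVote Δ σ]? = some (Formula.neg (next A ψ)) ∧
      ∀ a : Sg, (a : Ag) ∉ A → a ∈ ord.N Δ σ)}

open Classical in
/-- The rule **Next**: the prestate `Γ_σ` to which the move vector `σ` leads from the
state `Δ`. -/
noncomputable def succPrestate (Δ : Set (Formula Ag AP)) (σ : Sg → ℕ) : Set (Formula Ag AP) :=
  let Γ : Set (Formula Ag AP) :=
    {φ | ∃ A, next A φ ∈ Δ ∧ σ ∈ ord.DPos Δ A φ} ∪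
    {χ | ∃ A ψ, A ≠ Sg ∧ Formula.neg (next A ψ) ∈ Δ ∧ σ ∈ ord.DNeg Δ A ψ ∧ χ = Formula.neg ψ}
  if Γ = ∅ then {top} else Γ

/-- The prestates of the pretableau for `θ`. -/
inductive Prestate (θ : Formula Ag AP) : Set (Formula Ag AP) → Prop
  | init : Prestate θ {θ}
  | next (Γ Δ : Set (Formula Ag AP)) (σ : Sg → ℕ) (hΓ : Prestate θ Γ) (hΔ : Unwinds Sg Γ Δ)
      (hc : ¬ PatentlyInconsistent Δ) (hσ : σ ∈ ord.D Δ) : Prestate θ (ord.succPrestate Δ σ)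

/-! ### The tableau: prestate elimination -/

/-- The states of the pretableau, which are those of the initial tableau. -/
def initialStates (θ : Formula Ag AP) : Set (Set (Formula Ag AP)) :=
  {Δ | ∃ Γ, ord.Prestate θ Γ ∧ Unwinds Sg Γ Δ}

/-- The edge `Δ —σ→ Δ'` of the initial tableau. -/
def Edge (Δ : Set (Formula Ag AP)) (σ : Sg → ℕ) (Δ' : Set (Formula Ag AP)) : Prop :=
  ¬ PatentlyInconsistent Δ ∧ σ ∈ ord.D Δ ∧ Unwinds Sg (ord.succPrestate Δ σ) Δ'

/-! ### The tableau: state elimination -/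

/-- `⟨⟨A⟩⟩ φ U ψ` is realized at `Δ` in the tableau with the set of states `S`. In the second
clause `t` picks a suitable successor state for each of the move vectors. -/
inductive RealizedUntil (S : Set (Set (Formula Ag AP))) (A : Finset Ag) (φ ψ : Formula Ag AP) :
    Set (Formula Ag AP) → Prop
  | now (Δ : Set (Formula Ag AP)) (hS : Δ ∈ S) (hψ : ψ ∈ Δ) (hU : untl A φ ψ ∈ Δ) :
      RealizedUntil S A φ ψ Δ
  | later (Δ : Set (Formula Ag AP)) (hS : Δ ∈ S) (hφ : φ ∈ Δ)
      (hX : Formula.next A (untl A φ ψ) ∈ Δ) (hU : untl A φ ψ ∈ Δ)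
      (t : (Sg → ℕ) → Set (Formula Ag AP))
      (ht : ∀ σ ∈ ord.DPos Δ A (untl A φ ψ), t σ ∈ S ∧ ord.Edge Δ σ (t σ))
      (hr : ∀ σ ∈ ord.DPos Δ A (untl A φ ψ), RealizedUntil S A φ ψ (t σ)) :
      RealizedUntil S A φ ψ Δ

/-- `¬⟨⟨A⟩⟩□φ` is realized at `Δ` in the tableau with the set of states `S`. -/
inductive RealizedNegBox (S : Set (Set (Formula Ag AP))) (A : Finset Ag) (φ : Formula Ag AP) :
    Set (Formula Ag AP) → Prop
  | now (Δ : Set (Formula Ag AP)) (hS : Δ ∈ S) (hφ : Formula.neg φ ∈ Δ)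
      (hB : Formula.neg (box A φ) ∈ Δ) : RealizedNegBox S A φ Δ
  | later (Δ : Set (Formula Ag AP)) (hS : Δ ∈ S)
      (hX : Formula.neg (Formula.next A (box A φ)) ∈ Δ) (hB : Formula.neg (box A φ) ∈ Δ)
      (t : (Sg → ℕ) → Set (Formula Ag AP))
      (ht : ∀ σ ∈ ord.DNeg Δ A (box A φ), t σ ∈ S ∧ ord.Edge Δ σ (t σ))
      (hr : ∀ σ ∈ ord.DNeg Δ A (box A φ), RealizedNegBox S A φ (t σ)) :
      RealizedNegBox S A φ Δ

/-- The rule **E2** applies to `Δ`: for some move vector no successor state is left. -/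
def LacksSuccessor (S : Set (Set (Formula Ag AP))) (Δ : Set (Formula Ag AP)) : Prop :=
  ∃ σ ∈ ord.D Δ, ∀ Δ', ord.Edge Δ σ Δ' → Δ' ∉ S

/-- The rule **E3** applies to `Δ`: it contains an eventuality that is not realized at `Δ`. -/
def HasUnrealized (S : Set (Set (Formula Ag AP))) (Δ : Set (Formula Ag AP)) : Prop :=
  (∃ A φ ψ, untl A φ ψ ∈ Δ ∧ ¬ ord.RealizedUntil S A φ ψ Δ) ∨
  (∃ A φ, Formula.neg (box A φ) ∈ Δ ∧ ¬ ord.RealizedNegBox S A φ Δ)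

/-- One stage of the elimination phase: one state is removed by **E1**, **E2** or **E3**. -/
def ElimStep (S S' : Set (Set (Formula Ag AP))) : Prop :=
  ∃ Δ ∈ S, (PatentlyInconsistent Δ ∨ ord.LacksSuccessor S Δ ∨ ord.HasUnrealized S Δ) ∧
    S' = S \ {Δ}

/-- `T` is the set of states of the final tableau for `θ`: it is reached from the initial tableau
by finitely many eliminations, and no further elimination is possible. -/
def IsFinalTableau (θ : Formula Ag AP) (T : Set (Set (Formula Ag AP))) : Prop :=
  Relation.ReflTransGen ord.ElimStep (ord.initialStates θ) T ∧ ∀ T', ¬ ord.ElimStep T T'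

end NextOrder

end Tableau

/-- A tableau for `θ` with set of states `T` is open if some state contains `θ`. -/
def TableauOpen {Ag AP : Type} (θ : Formula Ag AP) (T : Set (Set (Formula Ag AP))) : Prop :=
  ∃ Δ ∈ T, θ ∈ Δ

end ATL

/-! All tableau states lie in one finite set closed under decomposition, so the final tableau is a
finite set of finite sets. No rule applies to it: its states are consistent, have a successor for
every vote vector and realize their eventualities. Realization is well-founded and vote vectors are
finitely many, so an eventuality has a finite rank wherever it occurs; while it is unfulfilled,
every vote vector postponing it has a successor of smaller rank (`IsStable.exists_edge_rank_lt`).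

One vote vector may need different successors for different eventualities, and a positional strategy
cannot remember which one is due. The memory is therefore put into the frame: a state is a tableau
state with the index of a formula, and the transition function picks the successor good for that
formula. The index stays while the votes postpone the formula and moves on cyclically otherwise.
Ranks cannot fall forever, so on each run every formula is given up at some time. Voting always for
the next-time formula of an eventuality depends on the tableau state only and keeps the eventuality
pending until it is fulfilled; as it would never be given up while pending, it is fulfilled
(`IsStable.exists_fulfilled`). For negated boxes, the agents outside the coalition steer the
collective vote (`exists_completion`).

The result is a positional Hintikka structure. Its labels are true under every recall
(`IsHintikka.truth`): a positional strategy may ignore the history, and a positional co-strategy can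
be played against any strategy with memory. -/

namespace ATL

open Formula

/-! ### Finite closures -/

section Closure

variable {Ag AP : Type} [Inhabited AP]

/-- Sets closed under decomposition of `α`- and `β`-formulae and under taking the formulae that a
next-time formula passes on to successors. -/
structure DecompClosed (Sg : Finset Ag) (C : Set (Formula Ag AP)) : Prop where
  alpha : ∀ χ χ₁ χ₂, Alpha Sg χ χ₁ χ₂ → χ ∈ C → χ₁ ∈ C ∧ χ₂ ∈ C
  beta : ∀ χ χ₁ χ₂, Beta χ χ₁ χ₂ → χ ∈ C → χ₁ ∈ C ∧ χ₂ ∈ C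
  next : ∀ A φ, Formula.next A φ ∈ C → φ ∈ C
  neg_next : ∀ A φ, neg (Formula.next A φ) ∈ C → neg φ ∈ C

variable {Sg : Finset Ag}

theorem DecompClosed.union {C C' : Set (Formula Ag AP)} (h : DecompClosed Sg C)
    (h' : DecompClosed Sg C') : DecompClosed Sg (C ∪ C') where
  alpha χ χ₁ χ₂ hα := by
    rintro (hm | hm)
    · exact (h.alpha _ _ _ hα hm).imp Or.inl Or.inl
    · exact (h'.alpha _ _ _ hα hm).imp Or.inr Or.inr
  beta χ χ₁ χ₂ hβ := by
    rintro (hm | hm)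
    · exact (h.beta _ _ _ hβ hm).imp Or.inl Or.inl
    · exact (h'.beta _ _ _ hβ hm).imp Or.inr Or.inr
  next A φ := Or.imp (h.next A φ) (h'.next A φ)
  neg_next A φ := Or.imp (h.neg_next A φ) (h'.neg_next A φ)

theorem DecompClosed.inter {C C' : Set (Formula Ag AP)} (h : DecompClosed Sg C)
    (h' : DecompClosed Sg C') : DecompClosed Sg (C ∩ C') where
  alpha _ _ _ hα hm :=
    ⟨⟨(h.alpha _ _ _ hα hm.1).1, (h'.alpha _ _ _ hα hm.2).1⟩,
      (h.alpha _ _ _ hα hm.1).2, (h'.alpha _ _ _ hα hm.2).2⟩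
  beta _ _ _ hβ hm :=
    ⟨⟨(h.beta _ _ _ hβ hm.1).1, (h'.beta _ _ _ hβ hm.2).1⟩,
      (h.beta _ _ _ hβ hm.1).2, (h'.beta _ _ _ hβ hm.2).2⟩
  next A φ hm := ⟨h.next A φ hm.1, h'.next A φ hm.2⟩
  neg_next A φ hm := ⟨h.neg_next A φ hm.1, h'.neg_next A φ hm.2⟩

/-- Decomposition creates no new agents: the only coalition it introduces is `∅`, in `next ∅ (neg
φ)`. -/
theorem decompClosed_agents [DecidableEq Ag] (Sg : Finset Ag) :
    DecompClosed Sg {χ : Formula Ag AP | χ.agents ⊆ Sg} where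
  alpha _ _ _ hα hm := by
    cases hα <;> simp_all [agents, Finset.union_subset_iff]
  beta _ _ _ hβ hm := by
    cases hβ <;> simp_all [agents, conj, Finset.union_subset_iff]
  next A φ hm := by simp_all [agents, Finset.union_subset_iff]
  neg_next A φ hm := by simp_all [agents, Finset.union_subset_iff]

/-- Every formula lies, together with its negation, in a finite closed set. -/
theorem exists_finite_decompClosed (Sg : Finset Ag) (φ : Formula Ag AP) :
    ∃ C : Set (Formula Ag AP), C.Finite ∧ DecompClosed Sg C ∧ φ ∈ C ∧ neg φ ∈ C := by
  -- Carrying `neg φ` along is what the induction needs, since decomposition negates immediate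
  -- subformulae.
  induction φ with
  | atom p =>
    refine ⟨{atom p, neg (atom p)}, by simp, ⟨?_, ?_, ?_, ?_⟩, by simp, by simp⟩
    · rintro χ χ₁ χ₂ h (rfl | rfl) <;> cases h
    · rintro χ χ₁ χ₂ h (rfl | rfl) <;> cases h
    · rintro A φ h
      simp at h
    · rintro A φ h
      simp at h
  | neg φ ih =>
    obtain ⟨C, hf, hC, h1, h2⟩ := ih
    refine ⟨insert (neg (neg φ)) C, hf.insert _, ⟨?_, ?_, ?_, ?_⟩, by simp [h2], by simp⟩
    · rintro χ χ₁ χ₂ h (rfl | hm)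
      · cases h; simp [h1]
      · exact (hC.alpha _ _ _ h hm).imp Or.inr Or.inr
    · rintro χ χ₁ χ₂ h (rfl | hm)
      · cases h
      · exact (hC.beta _ _ _ h hm).imp Or.inr Or.inr
    · rintro A ψ (hm | hm)
      · cases hm
      · exact Or.inr (hC.next _ _ hm)
    · rintro A ψ (hm | hm)
      · cases hm
      · exact Or.inr (hC.neg_next _ _ hm)
  | imp φ ψ ih ih' =>
    obtain ⟨C, hf, hC, h1, h2⟩ := ih
    obtain ⟨C', hf', hC', h1', h2'⟩ := ih'
    have hU := hC.union hC'
    refine ⟨insert (imp φ ψ) (insert (neg (imp φ ψ)) (C ∪ C')), by simp [hf, hf'],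
      ⟨?_, ?_, ?_, ?_⟩, by simp, by simp⟩
    · rintro χ χ₁ χ₂ h (rfl | rfl | hm)
      · cases h
      · cases h; simp [h1, h2']
      · exact (hU.alpha _ _ _ h hm).imp (Or.inr ∘ Or.inr) (Or.inr ∘ Or.inr)
    · rintro χ χ₁ χ₂ h (rfl | rfl | hm)
      · cases h; simp [h2, h1']
      · cases h
      · exact (hU.beta _ _ _ h hm).imp (Or.inr ∘ Or.inr) (Or.inr ∘ Or.inr)
    · rintro A ψ (hm | hm | hm)
      · cases hm
      · cases hm
      · exact Or.inr (Or.inr (hU.next _ _ hm))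
    · rintro A ψ (hm | hm | hm)
      · cases hm
      · cases hm
      · exact Or.inr (Or.inr (hU.neg_next _ _ hm))
  | next A φ ih =>
    obtain ⟨C, hf, hC, h1, h2⟩ := ih
    -- The third formula is needed only for `A = Sg`; including it always does no harm.
    refine ⟨{next A φ, neg (next A φ), next ∅ (neg φ)} ∪ C, Set.Finite.union (by simp) hf,
      ⟨?_, ?_, ?_, ?_⟩, by simp, by simp⟩
    · rintro χ χ₁ χ₂ h ((rfl | rfl | rfl) | hm)
      · cases h
      · cases h; simp
      · cases h
      · exact (hC.alpha _ _ _ h hm).imp Or.inr Or.inr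
    · rintro χ χ₁ χ₂ h ((rfl | rfl | rfl) | hm)
      iterate 3 cases h
      exact (hC.beta _ _ _ h hm).imp Or.inr Or.inr
    · rintro A ψ ((hm | hm | hm) | hm)
      · cases hm; exact Or.inr h1
      · cases hm
      · cases hm; exact Or.inr h2
      · exact Or.inr (hC.next _ _ hm)
    · rintro A ψ ((hm | hm | hm) | hm)
      · cases hm
      · cases hm; exact Or.inr h2
      · cases hm
      · exact Or.inr (hC.neg_next _ _ hm)
  | box A φ ih =>
    obtain ⟨C, hf, hC, h1, h2⟩ := ih
    refine ⟨{box A φ, neg (box A φ), next A (box A φ), neg (next A (box A φ)),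
      next ∅ (neg (box A φ))} ∪ C, Set.Finite.union (by simp) hf,
      ⟨?_, ?_, ?_, ?_⟩, by simp, by simp⟩
    · rintro χ χ₁ χ₂ h ((rfl | rfl | rfl | rfl | rfl) | hm)
      · cases h; simp [h1]
      · cases h
      · cases h
      · cases h; simp
      · cases h
      · exact (hC.alpha _ _ _ h hm).imp Or.inr Or.inr
    · rintro χ χ₁ χ₂ h ((rfl | rfl | rfl | rfl | rfl) | hm)
      · cases h
      · cases h; simp [h2]
      iterate 3 cases h
      exact (hC.beta _ _ _ h hm).imp Or.inr Or.inr
    · rintro B ψ ((hm | hm | hm | hm | hm) | hm)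
      iterate 2 cases hm
      · cases hm; simp
      · cases hm
      · cases hm; simp
      · exact Or.inr (hC.next _ _ hm)
    · rintro B ψ ((hm | hm | hm | hm | hm) | hm)
      iterate 3 cases hm
      · cases hm; simp
      · cases hm
      · exact Or.inr (hC.neg_next _ _ hm)
  | untl A φ ψ ih ih' =>
    obtain ⟨C, hf, hC, h1, h2⟩ := ih
    obtain ⟨C', hf', hC', h1', h2'⟩ := ih'
    have hU := hC.union hC'
    -- Since `conj χ χ'` is `neg (imp χ (neg χ'))`, its α-conjuncts are `χ` and `neg (neg χ')`;
    -- hence the multiple negations.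
    refine ⟨{untl A φ ψ, neg (untl A φ ψ), next A (untl A φ ψ), neg (next A (untl A φ ψ)),
      next ∅ (neg (untl A φ ψ)), neg (neg (next A (untl A φ ψ))),
      neg (neg (neg (next A (untl A φ ψ)))), neg (neg (neg φ)),
      conj φ (next A (untl A φ ψ)), conj (neg ψ) (neg φ),
      conj (neg ψ) (neg (next A (untl A φ ψ)))} ∪ (C ∪ C'),
      Set.Finite.union (by simp) (hf.union hf'), ⟨?_, ?_, ?_, ?_⟩, by simp, by simp⟩
    · rintro χ χ₁ χ₂ h ((rfl | rfl | rfl | rfl | rfl | rfl | rfl | rfl | rfl | rfl | rfl) | hm)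
      all_goals first
        | exact (hU.alpha _ _ _ h hm).imp Or.inr Or.inr
        | (cases h; done)
        | (cases h; simp [h1, h2, h2'])
    · rintro χ χ₁ χ₂ h ((rfl | rfl | rfl | rfl | rfl | rfl | rfl | rfl | rfl | rfl | rfl) | hm)
      all_goals first
        | exact (hU.beta _ _ _ h hm).imp Or.inr Or.inr
        | (cases h; done)
        | (cases h; simp [h1'])
    · rintro B χ (hm | hm)
      · rcases hm with hm | hm | hm | hm | hm | hm | hm | hm | hm | hm | hm
        all_goals first
          | (cases hm; done)
          | (cases hm; simp)
      · exact Or.inr (hU.next _ _ hm)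
    · rintro B χ (hm | hm)
      · rcases hm with hm | hm | hm | hm | hm | hm | hm | hm | hm | hm | hm
        all_goals first
          | (cases hm; done)
          | (cases hm; simp)
      · exact Or.inr (hU.neg_next _ _ hm)

/-- The closure used for the tableau of `θ`. -/
theorem exists_tableau_closure [DecidableEq Ag] {θ : Formula Ag AP} (hθ : θ.agents ⊆ Sg) :
    ∃ C : Set (Formula Ag AP), C.Finite ∧ DecompClosed Sg C ∧ θ ∈ C ∧ next Sg top ∈ C ∧
      ∀ χ ∈ C, χ.agents ⊆ Sg := by
  obtain ⟨C, hf, hC, h, -⟩ := exists_finite_decompClosed Sg θ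
  obtain ⟨C', hf', hC', h', -⟩ := exists_finite_decompClosed Sg (next Sg (top : Formula Ag AP))
  refine ⟨(C ∪ C') ∩ {χ | χ.agents ⊆ Sg}, (hf.union hf').inter_of_left _,
    (hC.union hC').inter (decompClosed_agents Sg), ⟨Or.inl h, hθ⟩, ⟨Or.inr h', ?_⟩,
    fun χ hχ => hχ.2⟩
  simp [agents, top]

end Closure

/-! ### Stable tableaux -/

section Stable

variable {Ag AP : Type} [Inhabited AP] {Sg : Finset Ag}

theorem Unwinds.subset {Γ Δ : Set (Formula Ag AP)} (h : Unwinds Sg Γ Δ) : Γ ⊆ Δ := by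
  obtain ⟨Δ₀, h₀, ⟨-, rfl⟩ | ⟨-, rfl⟩⟩ := h
  · exact h₀.1
  · exact h₀.1.trans (Set.subset_insert _ _)

/-- A positive next-time formula is neither an α- nor a β-formula, so it imposes no new condition.
-/
theorem DownwardSaturated.insert_next {Δ : Set (Formula Ag AP)} (h : DownwardSaturated Sg Δ)
    (A : Finset Ag) (φ : Formula Ag AP) : DownwardSaturated Sg (insert (next A φ) Δ) := by
  constructor
  · rintro χ χ₁ χ₂ hα (rfl | hm)
    · cases hα
    · exact (h.1 _ _ _ hα hm).imp Or.inr Or.inr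
  · rintro χ χ₁ χ₂ hβ (rfl | hm)
    · cases hβ
    · exact (h.2 _ _ _ hβ hm).imp Or.inr Or.inr

theorem Unwinds.downwardSaturated {Γ Δ : Set (Formula Ag AP)} (h : Unwinds Sg Γ Δ) :
    DownwardSaturated Sg Δ := by
  obtain ⟨Δ₀, h₀, ⟨-, rfl⟩ | ⟨-, rfl⟩⟩ := h
  · exact h₀.2.1
  · exact h₀.2.1.insert_next _ _

theorem Unwinds.hasNext {Γ Δ : Set (Formula Ag AP)} (h : Unwinds Sg Γ Δ) : HasNext Δ := by
  obtain ⟨Δ₀, h₀, ⟨h, rfl⟩ | ⟨-, rfl⟩⟩ := h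
  · exact h
  · exact ⟨_, _, Or.inl (Set.mem_insert _ _)⟩

/-- A minimal downward saturated extension stays inside every closed set. -/
theorem IsMinimalExtension.subset_of_closed {C Γ Δ : Set (Formula Ag AP)}
    (hC : DecompClosed Sg C) (h : IsMinimalExtension Sg Γ Δ) (hΓ : Γ ⊆ C) : Δ ⊆ C := by
  by_contra hn
  -- Cutting down to the closed set `C` preserves saturation, so minimality forbids formulae outside
  -- `C`.
  refine h.2.2 ⟨Δ ∩ C, ⟨?_, ?_⟩, Set.subset_inter h.1 hΓ, Set.inter_subset_left, ?_⟩
  · intro χ χ₁ χ₂ hα hm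
    have h1 := h.2.1.1 _ _ _ hα hm.1
    have h2 := hC.alpha _ _ _ hα hm.2
    exact ⟨⟨h1.1, h2.1⟩, h1.2, h2.2⟩
  · intro χ χ₁ χ₂ hβ hm
    have h2 := hC.beta _ _ _ hβ hm.2
    exact (h.2.1.2 _ _ _ hβ hm.1).imp (fun h => ⟨h, h2.1⟩) (fun h => ⟨h, h2.2⟩)
  · exact fun hs => hn fun x hx => (hs hx).2

theorem Unwinds.subset_of_closed {C Γ Δ : Set (Formula Ag AP)} (hC : DecompClosed Sg C)
    (htop : next Sg top ∈ C) (h : Unwinds Sg Γ Δ) (hΓ : Γ ⊆ C) : Δ ⊆ C := by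
  obtain ⟨Δ₀, h₀, ⟨-, rfl⟩ | ⟨-, rfl⟩⟩ := h
  · exact h₀.subset_of_closed hC hΓ
  · exact Set.insert_subset htop (h₀.subset_of_closed hC hΓ)

namespace NextOrder

variable (ord : NextOrder Sg AP)

theorem succPrestate_subset_of_closed {C Δ : Set (Formula Ag AP)} (hC : DecompClosed Sg C)
    (htop : Formula.next Sg top ∈ C) (hΔ : Δ ⊆ C) (σ : Sg → ℕ) : ord.succPrestate Δ σ ⊆ C := by
  unfold succPrestate
  dsimp only
  split_ifs
  · rintro _ rfl
    exact hC.next _ _ htop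
  · rintro χ (⟨A, h, -⟩ | ⟨A, ψ, -, h, -, rfl⟩)
    · exact hC.next _ _ (hΔ h)
    · exact hC.neg_next _ _ (hΔ h)

theorem Prestate.subset_of_closed {ord : NextOrder Sg AP} {θ : Formula Ag AP}
    {C Γ : Set (Formula Ag AP)} (hC : DecompClosed Sg C)
    (htop : Formula.next Sg top ∈ C) (hθ : θ ∈ C) (h : ord.Prestate θ Γ) : Γ ⊆ C := by
  induction h with
  | init => simpa using hθ
  | next Γ Δ σ _ hΔ _ _ ih =>
    exact ord.succPrestate_subset_of_closed hC htop (hΔ.subset_of_closed hC htop ih) σ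

theorem mem_succPrestate {Δ : Set (Formula Ag AP)} {σ : Sg → ℕ} {A : Finset Ag}
    {φ : Formula Ag AP} (h : Formula.next A φ ∈ Δ) (hσ : σ ∈ ord.DPos Δ A φ) :
    φ ∈ ord.succPrestate Δ σ := by
  have hm : φ ∈ {φ | ∃ A, Formula.next A φ ∈ Δ ∧ σ ∈ ord.DPos Δ A φ} ∪
      {χ | ∃ A ψ, A ≠ Sg ∧ Formula.neg (Formula.next A ψ) ∈ Δ ∧ σ ∈ ord.DNeg Δ A ψ ∧
        χ = Formula.neg ψ} := Or.inl ⟨A, h, hσ⟩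
  unfold succPrestate
  dsimp only
  rwa [if_neg (Set.nonempty_iff_ne_empty.1 ⟨_, hm⟩)]

theorem neg_mem_succPrestate {Δ : Set (Formula Ag AP)} {σ : Sg → ℕ} {A : Finset Ag}
    {φ : Formula Ag AP} (hA : A ≠ Sg) (h : Formula.neg (Formula.next A φ) ∈ Δ)
    (hσ : σ ∈ ord.DNeg Δ A φ) : Formula.neg φ ∈ ord.succPrestate Δ σ := by
  have hm : Formula.neg φ ∈ {φ | ∃ A, Formula.next A φ ∈ Δ ∧ σ ∈ ord.DPos Δ A φ} ∪
      {χ | ∃ A ψ, A ≠ Sg ∧ Formula.neg (Formula.next A ψ) ∈ Δ ∧ σ ∈ ord.DNeg Δ A ψ ∧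
        χ = Formula.neg ψ} := Or.inr ⟨A, φ, hA, h, hσ, rfl⟩
  unfold succPrestate
  dsimp only
  rwa [if_neg (Set.nonempty_iff_ne_empty.1 ⟨_, hm⟩)]

/-- A finite set of finite, consistent and saturated tableau states to which none of the
elimination rules applies. -/
structure IsStable (T : Set (Set (Formula Ag AP))) : Prop where
  finite : T.Finite
  finite_of_mem : ∀ Δ ∈ T, Δ.Finite
  agents_subset [DecidableEq Ag] : ∀ Δ ∈ T, ∀ χ ∈ Δ, χ.agents ⊆ Sg
  saturated : ∀ Δ ∈ T, DownwardSaturated Sg Δ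
  consistent : ∀ Δ ∈ T, ¬ PatentlyInconsistent Δ
  hasNext : ∀ Δ ∈ T, HasNext Δ
  exists_edge : ∀ Δ ∈ T, ∀ σ ∈ ord.D Δ, ∃ Δ' ∈ T, ord.Edge Δ σ Δ'
  realizedUntil : ∀ Δ ∈ T, ∀ A φ ψ, untl A φ ψ ∈ Δ → ord.RealizedUntil T A φ ψ Δ
  realizedNegBox : ∀ Δ ∈ T, ∀ A φ, Formula.neg (box A φ) ∈ Δ → ord.RealizedNegBox T A φ Δ

theorem IsFinalTableau.subset {ord : NextOrder Sg AP} {θ : Formula Ag AP}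
    {T : Set (Set (Formula Ag AP))} (hT : ord.IsFinalTableau θ T) :
    T ⊆ ord.initialStates θ := by
  have h := hT.1
  clear hT
  induction h with
  | refl => exact subset_rfl
  | tail _ h ih =>
    obtain ⟨Δ, -, -, rfl⟩ := h
    exact Set.sdiff_subset.trans ih

/-- Finiteness and the bound on agents come from the closure, saturation and next-time formulae from
unwinding, and the rest from the failure of **E1**–**E3**. -/
theorem IsFinalTableau.isStable [DecidableEq Ag] {ord : NextOrder Sg AP} {θ : Formula Ag AP}
    (hθ : θ.agents ⊆ Sg) {T : Set (Set (Formula Ag AP))} (hT : ord.IsFinalTableau θ T) :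
    ord.IsStable T := by
  obtain ⟨C, hf, hC, hθC, htop, hag⟩ := exists_tableau_closure hθ
  have hsub : ∀ Δ ∈ T, Δ ⊆ C := by
    intro Δ hΔ
    obtain ⟨Γ, hΓ, hu⟩ := hT.subset hΔ
    exact hu.subset_of_closed hC htop (hΓ.subset_of_closed hC htop hθC)
  have hkeep : ∀ Δ ∈ T, ¬ (PatentlyInconsistent Δ ∨ ord.LacksSuccessor T Δ ∨
      ord.HasUnrealized T Δ) := fun Δ hΔ h => hT.2 _ ⟨Δ, hΔ, h, rfl⟩
  refine ⟨hf.finite_subsets.subset hsub, fun Δ hΔ => hf.subset (hsub Δ hΔ), ?_,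
    fun Δ hΔ => ?_, fun Δ hΔ h => hkeep Δ hΔ (Or.inl h), fun Δ hΔ => ?_, fun Δ hΔ σ hσ => ?_,
    fun Δ hΔ A φ ψ hm => ?_, fun Δ hΔ A φ hm => ?_⟩
  · intro _ Δ hΔ χ hχ
    -- The set of agents is computed with two instances of decidable equality, which agree.
    convert hag χ (hsub Δ hΔ hχ)
  · obtain ⟨Γ, -, hu⟩ := hT.subset hΔ
    exact hu.downwardSaturated
  · obtain ⟨Γ, -, hu⟩ := hT.subset hΔ
    exact hu.hasNext
  · by_contra hn
    push Not at hn
    exact hkeep Δ hΔ (Or.inr (Or.inl ⟨σ, hσ, fun Δ' he hm => hn Δ' hm he⟩))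
  · by_contra hn
    exact hkeep Δ hΔ (Or.inr (Or.inr (Or.inl ⟨A, φ, ψ, hm, hn⟩)))
  · by_contra hn
    exact hkeep Δ hΔ (Or.inr (Or.inr (Or.inr ⟨A, φ, hm, hn⟩)))

/-! ### Ranks of eventualities -/

/-- The eventuality `ξ` is fulfilled at `Δ`. -/
def Fulfilled : Formula Ag AP → Set (Formula Ag AP) → Prop
  | untl _ _ ψ, Δ => ψ ∈ Δ
  | .neg (box _ φ), Δ => Formula.neg φ ∈ Δ
  -- Formulae that are not eventualities count as fulfilled, so they are never pursued.
  | _, _ => True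

/-- The move vectors at `Δ` that postpone the eventuality `ξ`. -/
def pursuit : Formula Ag AP → Set (Formula Ag AP) → Set (Sg → ℕ)
  | untl A φ ψ, Δ => ord.DPos Δ A (untl A φ ψ)
  | .neg (box A φ), Δ => ord.DNeg Δ A (box A φ)
  | _, _ => ∅

/-- Within the set of states `T`, the eventuality `ξ` is realized at `Δ` in at most `n` steps. -/
def RealizedIn (T : Set (Set (Formula Ag AP))) (ξ : Formula Ag AP) :
    ℕ → Set (Formula Ag AP) → Prop
  | 0, Δ => Fulfilled ξ Δ
  | n + 1, Δ => Fulfilled ξ Δ ∨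
      ∀ σ ∈ ord.pursuit ξ Δ, ∃ Δ' ∈ T, ord.Edge Δ σ Δ' ∧ RealizedIn T ξ n Δ'

theorem RealizedIn.mono {ord : NextOrder Sg AP} {T : Set (Set (Formula Ag AP))}
    {ξ : Formula Ag AP} {n m : ℕ} (hnm : n ≤ m) :
    ∀ {Δ}, ord.RealizedIn T ξ n Δ → ord.RealizedIn T ξ m Δ := by
  induction n generalizing m with
  | zero =>
    intro Δ h
    cases m with
    | zero => exact h
    | succ m => exact Or.inl h
  | succ n ih =>
    intro Δ h
    obtain ⟨m, rfl⟩ := Nat.exists_eq_add_of_le' (Nat.succ_pos n |>.trans_le hnm)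
    refine h.imp id fun h σ hσ => ?_
    obtain ⟨Δ', h1, h2, h3⟩ := h σ hσ
    exact ⟨Δ', h1, h2, ih (by omega) h3⟩

omit [Inhabited AP] in
theorem finite_D (Δ : Set (Formula Ag AP)) : (ord.D Δ).Finite := by
  have h : ord.D Δ = Set.pi Set.univ fun _ => Set.Iio (ord.list Δ).length := by
    ext σ
    simp [D]
  rw [h]
  exact Set.Finite.pi fun _ => Set.finite_Iio _

omit [Inhabited AP] in
theorem pursuit_subset_D (ξ : Formula Ag AP) (Δ : Set (Formula Ag AP)) :
    ord.pursuit ξ Δ ⊆ ord.D Δ := by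
  intro σ hσ
  unfold pursuit at hσ
  split at hσ
  · exact hσ.1
  · exact hσ.1
  · exact hσ.elim

/-- Only finitely many move vectors exist at `Δ`, so the step counts of the chosen successors have a
common bound. -/
theorem exists_realizedIn_of_pursuit {T : Set (Set (Formula Ag AP))} {ξ : Formula Ag AP}
    {Δ : Set (Formula Ag AP)} {t : (Sg → ℕ) → Set (Formula Ag AP)}
    (ht : ∀ σ ∈ ord.pursuit ξ Δ, t σ ∈ T ∧ ord.Edge Δ σ (t σ))
    (hr : ∀ σ ∈ ord.pursuit ξ Δ, ∃ n, ord.RealizedIn T ξ n (t σ)) :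
    ∃ n, ord.RealizedIn T ξ n Δ := by
  choose! r hr using hr
  obtain ⟨b, hb⟩ := (((ord.finite_D Δ).subset (ord.pursuit_subset_D ξ Δ)).image r).bddAbove
  exact ⟨b + 1, Or.inr fun σ hσ => ⟨t σ, (ht σ hσ).1, (ht σ hσ).2,
    (hr σ hσ).mono (hb ⟨σ, hσ, rfl⟩)⟩⟩

variable {ord} {T : Set (Set (Formula Ag AP))}

theorem RealizedUntil.exists_realizedIn {A : Finset Ag} {φ ψ : Formula Ag AP}
    {Δ : Set (Formula Ag AP)} (h : ord.RealizedUntil T A φ ψ Δ) :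
    ∃ n, ord.RealizedIn T (untl A φ ψ) n Δ := by
  induction h with
  | now Δ _ hψ _ => exact ⟨0, hψ⟩
  | later Δ _ _ _ _ t ht _ ih => exact ord.exists_realizedIn_of_pursuit ht ih

theorem RealizedNegBox.exists_realizedIn {A : Finset Ag} {φ : Formula Ag AP}
    {Δ : Set (Formula Ag AP)} (h : ord.RealizedNegBox T A φ Δ) :
    ∃ n, ord.RealizedIn T (Formula.neg (box A φ)) n Δ := by
  induction h with
  | now Δ _ hψ _ => exact ⟨0, hψ⟩
  | later Δ _ _ _ t ht _ ih => exact ord.exists_realizedIn_of_pursuit ht ih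

theorem IsStable.exists_realizedIn (hT : ord.IsStable T) {Δ : Set (Formula Ag AP)} (hΔ : Δ ∈ T)
    {ξ : Formula Ag AP} (hξ : ξ ∈ Δ) : ∃ n, ord.RealizedIn T ξ n Δ := by
  by_cases hf : Fulfilled ξ Δ
  · exact ⟨0, hf⟩
  · unfold Fulfilled at hf
    split at hf
    · exact (hT.realizedUntil Δ hΔ _ _ _ hξ).exists_realizedIn
    · exact (hT.realizedNegBox Δ hΔ _ _ hξ).exists_realizedIn
    · exact absurd trivial hf

variable (ord T) in
/-- The least number of steps in which `ξ` is realized at `Δ`. -/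
noncomputable def rank (ξ : Formula Ag AP) (Δ : Set (Formula Ag AP)) : ℕ :=
  sInf {n | ord.RealizedIn T ξ n Δ}

/-- Rank `0` would mean fulfilled; at rank `n + 1` each postponing vector has a successor where `n`
steps suffice. In all other cases any remaining successor will do. -/
theorem IsStable.exists_edge_rank_lt (hT : ord.IsStable T) {Δ : Set (Formula Ag AP)}
    (hΔ : Δ ∈ T) (ξ : Formula Ag AP) {σ : Sg → ℕ} (hσ : σ ∈ ord.D Δ) :
    ∃ Δ' ∈ T, ord.Edge Δ σ Δ' ∧ (ξ ∈ Δ → ¬ Fulfilled ξ Δ → σ ∈ ord.pursuit ξ Δ →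
      ord.rank T ξ Δ' < ord.rank T ξ Δ) := by
  by_cases h : ξ ∈ Δ ∧ ¬ Fulfilled ξ Δ ∧ σ ∈ ord.pursuit ξ Δ
  · obtain ⟨hξ, hf, hp⟩ := h
    have hr : ord.RealizedIn T ξ (ord.rank T ξ Δ) Δ := Nat.sInf_mem (hT.exists_realizedIn hΔ hξ)
    cases hn : ord.rank T ξ Δ with
    | zero =>
      rw [hn] at hr
      exact absurd hr hf
    | succ n =>
      rw [hn] at hr
      obtain ⟨Δ', h1, h2, h3⟩ := (hr.resolve_left hf) σ hp
      exact ⟨Δ', h1, h2, fun _ _ _ => Nat.lt_succ_of_le (Nat.sInf_le h3)⟩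
  · obtain ⟨Δ', h1, h2⟩ := hT.exists_edge Δ hΔ σ hσ
    exact ⟨Δ', h1, h2, fun a b c => absurd ⟨a, b, c⟩ h⟩

/-! ### Voting -/

theorem Edge.mem_of_next {Δ Δ' : Set (Formula Ag AP)} {σ : Sg → ℕ} (h : ord.Edge Δ σ Δ')
    {A : Finset Ag} {φ : Formula Ag AP} (hφ : Formula.next A φ ∈ Δ)
    (hσ : σ ∈ ord.DPos Δ A φ) : φ ∈ Δ' :=
  h.2.2.subset (ord.mem_succPrestate hφ hσ)

/-- For `A = Sg` the formula is not listed, but saturation supplies `next ∅ (neg φ)`, for which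
every vector votes. -/
theorem IsStable.neg_mem_of_edge (hT : ord.IsStable T) {Δ Δ' : Set (Formula Ag AP)}
    (hΔ : Δ ∈ T) {σ : Sg → ℕ} (h : ord.Edge Δ σ Δ') {A : Finset Ag} {φ : Formula Ag AP}
    (hφ : Formula.neg (Formula.next A φ) ∈ Δ) (hσ : σ ∈ ord.DNeg Δ A φ) :
    Formula.neg φ ∈ Δ' := by
  by_cases hA : A = Sg
  · subst hA
    exact h.mem_of_next ((hT.saturated Δ hΔ).1 _ _ _ (Alpha.neg_next_all φ) hφ).1
      ⟨hσ.1, fun a ha => absurd ha (Finset.notMem_empty _)⟩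
  · exact h.2.2.subset (ord.neg_mem_succPrestate hA hφ hσ)

/-- This gives each agent at least one move when votes serve as moves. An unlisted `neg (next Sg φ)`
is replaced by its conjunct. -/
theorem IsStable.length_pos (hT : ord.IsStable T) {Δ : Set (Formula Ag AP)} (hΔ : Δ ∈ T) :
    0 < (ord.list Δ).length := by
  have hfin := hT.finite_of_mem Δ hΔ
  have key : ∀ A φ, Formula.next A φ ∈ Δ → 0 < (ord.list Δ).length := fun A φ h =>
    List.length_pos_of_mem (a := Formula.next A φ)
      (List.mem_append_left _ ((ord.mem_pos Δ hfin _).2 ⟨h, A, φ, rfl⟩))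
  obtain ⟨A, φ, h | h⟩ := hT.hasNext Δ hΔ
  · exact key A φ h
  · by_cases hA : A = Sg
    · subst hA
      exact key _ _ ((hT.saturated Δ hΔ).1 _ _ _ (Alpha.neg_next_all φ) h).1
    · exact List.length_pos_of_mem (a := Formula.neg (Formula.next A φ))
        (List.mem_append_right _ ((ord.mem_neg Δ hfin _).2 ⟨h, A, φ, hA, rfl⟩))

omit [Inhabited AP] in
/-- The vote for a positive next-time formula. -/
theorem exists_vote (ord : NextOrder Sg AP) {Δ : Set (Formula Ag AP)} (hΔ : Δ.Finite)
    {A : Finset Ag} {φ : Formula Ag AP} (h : Formula.next A φ ∈ Δ) :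
    ∃ p : Fin (ord.list Δ).length, ∀ σ ∈ ord.D Δ, (∀ a : Sg, (a : Ag) ∈ A → σ a = p) →
      σ ∈ ord.DPos Δ A φ := by
  have hm : Formula.next A φ ∈ ord.list Δ :=
    List.mem_append_left _ ((ord.mem_pos Δ hΔ _).2 ⟨h, A, φ, rfl⟩)
  obtain ⟨p, hp, he⟩ := List.getElem_of_mem hm
  refine ⟨⟨p, hp⟩, fun σ hσ hA => ⟨hσ, fun a ha => ?_⟩⟩
  rw [hA a ha, List.getElem?_eq_getElem hp, he]

omit [Inhabited AP] in
open Classical in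
/-- The agents outside `A` can complete every vote of `A` to one that selects a given proper
negative next-time formula. -/
theorem exists_completion (ord : NextOrder Sg AP) {Δ : Set (Formula Ag AP)} (hΔ : Δ.Finite)
    {A : Finset Ag} {φ : Formula Ag AP} (hA : A ≠ Sg) (hAS : A ⊆ Sg)
    (h : Formula.neg (Formula.next A φ) ∈ Δ) {σ : Sg → ℕ} (hσ : σ ∈ ord.D Δ) :
    ∃ τ ∈ ord.DNeg Δ A φ, ∀ a : Sg, (a : Ag) ∈ A → τ a = σ a := by
  obtain ⟨q, hq, he⟩ := List.getElem_of_mem ((ord.mem_neg Δ hΔ _).2 ⟨h, A, φ, hA, rfl⟩)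
  obtain ⟨b, hb, hbA⟩ := Finset.exists_of_ssubset (hAS.ssubset_of_ne hA)
  set m := (ord.pos Δ).length with hm
  set l := (ord.neg Δ).length with hl
  have hlist : (ord.list Δ).length = m + l := List.length_append
  -- `K` is the total negative vote of `A`. Outside `A` only `b` contributes, namely `o ≡ q - K`
  -- modulo `l`; the others vote `m`, which is negative but adds `0`.
  let v : Sg → ℕ := fun a => if m ≤ σ a ∧ (a : Ag) ∈ A then σ a - m else 0
  let K : ℕ := ∑ a, v a
  let o : ℕ := (q + (l - K % l)) % l
  let τ : Sg → ℕ := fun a => if (a : Ag) ∈ A then σ a else if (a : Ag) = b then m + o else m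
  have hl0 : 0 < l := by omega
  have ho : o < l := Nat.mod_lt _ hl0
  have hτD : τ ∈ ord.D Δ := by
    intro a
    have := hσ a
    simp only [τ]
    split_ifs <;> omega
  have hsum : ∑ a ∈ ord.N Δ τ, (τ a - m) = K + o := by
    have h1 : ∑ a ∈ ord.N Δ τ, (τ a - m) = ∑ a, (v a + if a = ⟨b, hb⟩ then o else 0) := by
      unfold NextOrder.N
      rw [Finset.sum_filter]
      refine Finset.sum_congr rfl fun a _ => ?_
      have hab : a = ⟨b, hb⟩ ↔ (a : Ag) = b := Subtype.ext_iff
      simp only [τ, v, hab]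
      by_cases haA : (a : Ag) ∈ A
      · have : (a : Ag) ≠ b := fun h => hbA (h ▸ haA)
        simp [haA, this, ← hm]
      · by_cases hab : (a : Ag) = b <;> simp [haA, hab, hbA, ← hm]
    rw [h1, Finset.sum_add_distrib]
    simp [K]
  have hvote : ord.negVote Δ τ = q := by
    unfold NextOrder.negVote
    rw [← hm, ← hl, hsum]
    have hK : K % l < l := Nat.mod_lt _ hl0
    simp only [o]
    rw [Nat.add_mod_mod, ← Nat.mod_add_div K l]
    have : K % l + l * (K / l) + (q + (l - (K % l + l * (K / l)) % l)) =
        q + l * (K / l + 1) := by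
      rw [Nat.mod_add_div, mul_add]
      have := Nat.mod_add_div K l
      omega
    rw [this, Nat.add_mul_mod_self_left, Nat.mod_eq_of_lt hq]
  refine ⟨τ, ⟨hτD, fun _ => ⟨?_, fun a ha => ?_⟩⟩, fun a ha => by simp [τ, ha]⟩
  · rw [hvote, List.getElem?_eq_getElem hq, he]
  · simp only [NextOrder.N, Finset.mem_filter, Finset.mem_univ, true_and, τ, ha, if_false]
    split_ifs <;> omega

end NextOrder

end Stable

/-! ### Truth in Hintikka structures -/

section Truth

namespace CGF

variable {Ag : Type} {Sg : Finset Ag} {F : CGF Sg}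

theorem memory_one (lam : ℕ → F.State) (i : ℕ) : memory 1 lam i = [] := by
  simp [memory]

theorem mem_stratOut_one {A : Finset Ag} {s : F.State} {f : F.Strategy A} {lam : ℕ → F.State} :
    lam ∈ stratOut 1 s f ↔
      lam 0 = s ∧ ∀ i, lam (i + 1) ∈ moveOut (lam i) (f [] (lam i)) := by
  simp [stratOut, memory_one]

theorem mem_coStratOut_one {A : Finset Ag} {s : F.State} {f : F.CoStrategy A}
    {lam : ℕ → F.State} :
    lam ∈ coStratOut 1 s f ↔
      lam 0 = s ∧ ∀ i, lam (i + 1) ∈ coMoveOut (lam i) (f [] (lam i)) := by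
  simp [coStratOut, memory_one]

/-- What is remembered at `i` involves earlier positions only, which allows runs to be built
recursively. -/
theorem memory_congr (γ : ℕ∞) {lam lam' : ℕ → F.State} {i : ℕ} (h : ∀ k < i, lam k = lam' k) :
    memory γ lam i = memory γ lam' i := by
  unfold memory
  refine List.map_congr_left fun k hk => h k ?_
  rw [List.mem_range'_1] at hk
  omega

instance (A : Finset Ag) (s : F.State) : Nonempty (F.CoalMove A s) :=
  ⟨fun a _ => ⟨0, F.d_pos a s⟩⟩

open Classical in
instance (A : Finset Ag) (s : F.State) : Nonempty (F.CoMove A s) :=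
  ⟨⟨fun m a => if h : (a : Ag) ∈ A then m a h else ⟨0, F.d_pos a s⟩,
    fun m a h => by simp [h]⟩⟩

/-- An `A`-strategy can be played against a positional co-`A`-strategy. -/
theorem exists_run (γ : ℕ∞) {A : Finset Ag} (s : F.State) (g : F.Strategy A)
    (c : (s : F.State) → F.CoMove A s) :
    ∃ lam ∈ stratOut γ s g, ∀ i, lam (i + 1) ∈ coMoveOut (lam i) (c (lam i)) := by
  let step (lam : ℕ → F.State) (n : ℕ) : F.State :=
    F.δ (lam n) ((c (lam n)).1 (g (memory γ lam n) (lam n)))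
  -- `L n` is correct up to position `n`, and later steps leave these positions alone; the run is
  -- the diagonal.
  let L : ℕ → ℕ → F.State := fun n =>
    Nat.rec (fun _ => s) (fun n lam => Function.update lam (n + 1) (step lam n)) n
  have hL : ∀ n, L (n + 1) = Function.update (L n) (n + 1) (step (L n) n) := fun n => rfl
  have hst : ∀ k m, L (k + m) k = L k k := by
    intro k m
    induction m with
    | zero => rfl
    | succ m ih =>
      rw [← Nat.add_assoc, hL, Function.update_of_ne (by omega), ih]
  have hst' : ∀ n, ∀ k ≤ n, L n k = L k k := by
    intro n k hk
    obtain ⟨m, rfl⟩ := Nat.exists_eq_add_of_le hk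
    exact hst k m
  have hstep : ∀ n, L (n + 1) (n + 1) = step (fun k => L k k) n := by
    intro n
    rw [hL, Function.update_self]
    simp only [step]
    rw [memory_congr γ (lam' := fun k => L k k) fun k hk => hst' n k hk.le]
  refine ⟨fun k => L k k, ⟨rfl, fun i => ?_⟩, fun i => ?_⟩
  · exact ⟨_, (c (L i i)).2 _, (hstep i).symm⟩
  · exact ⟨_, (hstep i).symm⟩

end CGF

variable {Ag AP : Type} [Inhabited AP] {Sg : Finset Ag} {F : CGF Sg}
  {H : F.State → Set (Formula Ag AP)}

theorem IsHintikka.mem_of_conj_mem {γ : ℕ∞} (hH : IsHintikka γ F H) {s : F.State}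
    {φ ψ : Formula Ag AP} (h : conj φ ψ ∈ H s) : φ ∈ H s ∧ ψ ∈ H s := by
  have h1 := hH.H2 s _ _ _ (Alpha.neg_imp _ _) h
  exact ⟨h1.1, (hH.H2 s _ _ _ (Alpha.neg_neg _) h1.2).1⟩

/-- Membership in the labels of a positional Hintikka structure implies truth in every
semantics. -/
theorem IsHintikka.truth (hH : IsHintikka 1 F H) (γ : ℕ∞) (χ : Formula Ag AP) :
    ∀ s : F.State, (χ ∈ H s → (F.expand H).Sat γ χ s) ∧
      (neg χ ∈ H s → ¬ (F.expand H).Sat γ χ s) := by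
  induction χ with
  | atom p => exact fun s => ⟨fun h => h, fun h => hH.H1 s _ h⟩
  | neg φ ih =>
    exact fun s => ⟨fun h => (ih s).2 h,
      fun h hn => hn ((ih s).1 (hH.H2 s _ _ _ (Alpha.neg_neg φ) h).1)⟩
  | imp φ ψ ih ih' =>
    refine fun s => ⟨fun h hφ => ?_, fun h hn => ?_⟩
    · by_cases ht : imp φ ψ = top
      -- `⊤` is not decomposed, but it has the form `p → p`.
      · cases ht; exact hφ
      · rcases hH.H3 s _ _ _ (Beta.imp φ ψ ht) h with h | h
        · exact absurd hφ ((ih s).2 h)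
        · exact (ih' s).1 h
    · have h1 := hH.H2 s _ _ _ (Alpha.neg_imp φ ψ) h
      exact (ih' s).2 h1.2 (hn ((ih s).1 h1.1))
  | next A φ ih =>
    refine fun s => ⟨fun h => ?_, ?_⟩
    · obtain ⟨m, hm⟩ := hH.H4 s A φ h
      exact ⟨m, fun s' hs' => (ih s').1 (hm s' hs')⟩
    · rintro h ⟨m, hm⟩
      obtain ⟨c, hc⟩ := hH.H5 s A φ h
      exact (ih _).2 (hc _ ⟨m, rfl⟩) (hm _ ⟨_, c.2 m, rfl⟩)
  | box A φ ih =>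
    refine fun s => ⟨fun h => ?_, ?_⟩
    -- One move per state, chosen for the next-time formula, forms a positional strategy under which
    -- `box A φ` is invariant.
    · have hm : ∀ w : F.State, ∃ m : F.CoalMove A w, next A (box A φ) ∈ H w →
          ∀ s' ∈ CGF.moveOut w m, box A φ ∈ H s' := by
        intro w
        by_cases hw : next A (box A φ) ∈ H w
        · obtain ⟨m, hm⟩ := hH.H4 w _ _ hw
          exact ⟨m, fun _ => hm⟩
        · exact ⟨Classical.arbitrary _, fun h => absurd h hw⟩
      choose m hm using hm
      refine ⟨fun _ w => m w, fun lam hlam i => ?_⟩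
      have hb : ∀ i, box A φ ∈ H (lam i) := by
        intro i
        induction i with
        | zero => rw [hlam.1]; exact h
        | succ i ihi =>
          exact hm _ (hH.H2 _ _ _ _ (Alpha.box A φ) ihi).2 _ (hlam.2 i)
      exact (ih _).1 (hH.H2 _ _ _ _ (Alpha.box A φ) (hb i)).1
    · rintro h ⟨g, hg⟩
      obtain ⟨f, hf⟩ := hH.H7 s A φ h
      obtain ⟨lam, hlam, hc⟩ := CGF.exists_run γ s g (f [])
      obtain ⟨i, hi⟩ := hf lam (CGF.mem_coStratOut_one.2 ⟨hlam.1, hc⟩)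
      exact (ih _).2 hi (hg lam hlam i)
  | untl A φ ψ ih ih' =>
    refine fun s => ⟨fun h => ?_, ?_⟩
    · obtain ⟨f, hf⟩ := hH.H6 s A φ ψ h
      -- Positional outcomes use `f` at the empty history only; ignoring the history gives the same
      -- runs under every recall.
      refine ⟨fun _ w => f [] w, fun lam hlam => ?_⟩
      obtain ⟨i, hi, hj⟩ := hf lam (CGF.mem_stratOut_one.2 hlam)
      exact ⟨i, (ih' _).1 hi, fun j hji => (ih _).1 (hj j hji)⟩
    · rintro h ⟨g, hg⟩
      -- These co-moves preserve the negated until for as long as `φ` holds; both of its disjuncts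
      -- contain `neg ψ`, so `ψ` cannot be reached in time.
      have hc : ∀ w : F.State, ∃ c : F.CoMove A w, neg (next A (untl A φ ψ)) ∈ H w →
          ∀ s' ∈ CGF.coMoveOut w c, neg (untl A φ ψ) ∈ H s' := by
        intro w
        by_cases hw : neg (next A (untl A φ ψ)) ∈ H w
        · obtain ⟨c, hc⟩ := hH.H5 w _ _ hw
          exact ⟨c, fun _ => hc⟩
        · exact ⟨Classical.arbitrary _, fun h => absurd h hw⟩
      choose c hc using hc
      obtain ⟨lam, hlam, hrun⟩ := CGF.exists_run γ s g c
      obtain ⟨i, hi, hj⟩ := hg lam hlam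
      have hu : ∀ k ≤ i, neg (untl A φ ψ) ∈ H (lam k) := by
        intro k
        induction k with
        | zero => intro _; rw [hlam.1]; exact h
        | succ k ihk =>
          intro hk
          rcases hH.H3 _ _ _ _ (Beta.neg_untl A φ ψ) (ihk (by omega)) with h1 | h1
          · exact absurd (hj k (by omega)) ((ih _).2 (hH.mem_of_conj_mem h1).2)
          · exact hc _ (hH.mem_of_conj_mem h1).2 _ (hrun k)
      have hψ : neg ψ ∈ H (lam i) := by
        rcases hH.H3 _ _ _ _ (Beta.neg_untl A φ ψ) (hu i le_rfl) with h1 | h1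
        · exact (hH.mem_of_conj_mem h1).1
        · exact (hH.mem_of_conj_mem h1).1
      exact (ih' _).2 hψ hi

end Truth

/-! ### The pursuit frame -/

section Pursuit

variable {Ag AP : Type} [Inhabited AP] {Sg : Finset Ag}

namespace NextOrder

variable {ord : NextOrder Sg AP} {T : Set (Set (Formula Ag AP))}

/-- A successor of `Δ` that is closer to realizing `ξ` whenever `σ` postpones `ξ`. -/
noncomputable def IsStable.succ (hT : ord.IsStable T) (Δ : T) (ξ : Formula Ag AP)
    (σ : Sg → ℕ) (hσ : σ ∈ ord.D (Δ : Set (Formula Ag AP))) : T :=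
  ⟨(hT.exists_edge_rank_lt Δ.2 ξ hσ).choose, (hT.exists_edge_rank_lt Δ.2 ξ hσ).choose_spec.1⟩

theorem IsStable.edge_succ (hT : ord.IsStable T) (Δ : T) (ξ : Formula Ag AP) {σ : Sg → ℕ}
    (hσ : σ ∈ ord.D (Δ : Set (Formula Ag AP))) : ord.Edge (Δ : Set _) σ (hT.succ Δ ξ σ hσ) :=
  (hT.exists_edge_rank_lt Δ.2 ξ hσ).choose_spec.2.1

theorem IsStable.rank_succ_lt (hT : ord.IsStable T) (Δ : T) {ξ : Formula Ag AP} {σ : Sg → ℕ}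
    (hσ : σ ∈ ord.D (Δ : Set (Formula Ag AP))) (hξ : ξ ∈ (Δ : Set (Formula Ag AP)))
    (hf : ¬ Fulfilled ξ (Δ : Set (Formula Ag AP)))
    (hp : σ ∈ ord.pursuit ξ (Δ : Set (Formula Ag AP))) :
    ord.rank T ξ (hT.succ Δ ξ σ hσ : Set (Formula Ag AP)) < ord.rank T ξ Δ :=
  (hT.exists_edge_rank_lt Δ.2 ξ hσ).choose_spec.2.2 hξ hf hp

variable (ord) in
/-- The move vector `σ` keeps the unfulfilled eventuality `ξ` of `Δ` pending. -/
def Pursues (ξ : Formula Ag AP) (Δ : Set (Formula Ag AP)) (σ : Sg → ℕ) : Prop :=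
  ξ ∈ Δ ∧ ¬ Fulfilled ξ Δ ∧ σ ∈ ord.pursuit ξ Δ

open Classical in
/-- The frame whose states are tableau states paired with the index of a formula `ξ i` that is
pursued: as long as the moves postpone `ξ i`, the play gets closer to realizing it, and otherwise
the next formula is pursued. -/
noncomputable def IsStable.frame (hT : ord.IsStable T) (hSg : Sg.Nonempty) (hne : T.Nonempty)
    {n : ℕ} (ξ : Fin (n + 1) → Formula Ag AP) : CGF Sg where
  agents_nonempty := hSg
  State := T × Fin (n + 1)
  state_nonempty := ⟨⟨⟨_, hne.some_mem⟩, 0⟩⟩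
  d _ s := (ord.list (s.1 : Set (Formula Ag AP))).length
  d_pos _ s := hT.length_pos s.1.2
  δ s σ := (hT.succ s.1 (ξ s.2) (fun a => σ a) (fun a => (σ a).2),
    -- Addition in `Fin (n + 1)` wraps around, so every formula gets its turn.
    if ord.Pursues (ξ s.2) s.1 (fun a => σ a) then s.2 else s.2 + 1)

/-! ### Moves, runs and eventualities in the pursuit frame -/

section Frame

variable (hT : ord.IsStable T) (hSg : Sg.Nonempty) (hne : T.Nonempty) {n : ℕ}
  (ξ : Fin (n + 1) → Formula Ag AP)

/-- The label of a state of the pursuit frame. -/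
def IsStable.label (s : (hT.frame hSg hne ξ).State) : Set (Formula Ag AP) :=
  (Prod.fst s : T)

/-- The tableau move vector that corresponds to a move vector of the pursuit frame. -/
def IsStable.votes {s : (hT.frame hSg hne ξ).State} (σ : (hT.frame hSg hne ξ).MoveVec s) :
    Sg → ℕ := fun a => (σ a : Fin _).val

variable {hT hSg hne ξ}

theorem IsStable.label_mem (s : (hT.frame hSg hne ξ).State) : hT.label hSg hne ξ s ∈ T :=
  (Prod.fst s : T).2

theorem IsStable.votes_mem_D {s : (hT.frame hSg hne ξ).State}
    (σ : (hT.frame hSg hne ξ).MoveVec s) :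
    hT.votes hSg hne ξ σ ∈ ord.D (hT.label hSg hne ξ s) := fun a => (σ a).2

theorem IsStable.edge_δ {s : (hT.frame hSg hne ξ).State}
    (σ : (hT.frame hSg hne ξ).MoveVec s) :
    ord.Edge (hT.label hSg hne ξ s) (hT.votes hSg hne ξ σ)
      (hT.label hSg hne ξ ((hT.frame hSg hne ξ).δ s σ)) :=
  hT.edge_succ _ _ (IsStable.votes_mem_D σ)

theorem IsStable.δ_of_pursues {s : (hT.frame hSg hne ξ).State}
    {σ : (hT.frame hSg hne ξ).MoveVec s}
    (h : ord.Pursues (ξ s.2) (hT.label hSg hne ξ s) (hT.votes hSg hne ξ σ)) :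
    ((hT.frame hSg hne ξ).δ s σ).2 = s.2 ∧
      ord.rank T (ξ s.2) (hT.label hSg hne ξ ((hT.frame hSg hne ξ).δ s σ)) <
        ord.rank T (ξ s.2) (hT.label hSg hne ξ s) :=
  ⟨if_pos h, hT.rank_succ_lt _ (IsStable.votes_mem_D σ) h.1 h.2.1 h.2.2⟩

theorem IsStable.δ_of_not_pursues {s : (hT.frame hSg hne ξ).State}
    {σ : (hT.frame hSg hne ξ).MoveVec s}
    (h : ¬ ord.Pursues (ξ s.2) (hT.label hSg hne ξ s) (hT.votes hSg hne ξ σ)) :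
    ((hT.frame hSg hne ξ).δ s σ).2 = s.2 + 1 :=
  if_neg h

/-- On every run the formula that is pursued at some time is given up at a later time. -/
theorem IsStable.exists_not_pursues {lam : ℕ → (hT.frame hSg hne ξ).State}
    {σ : ∀ k, (hT.frame hSg hne ξ).MoveVec (lam k)}
    (hlam : ∀ k, lam (k + 1) = (hT.frame hSg hne ξ).δ (lam k) (σ k)) (k : ℕ) :
    ∃ k' ≥ k, (lam k').2 = (lam k).2 ∧
      ¬ ord.Pursues (ξ (lam k').2) (hT.label hSg hne ξ (lam k')) (hT.votes hSg hne ξ (σ k')) := by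
  -- While the pursuit lasts, the index is fixed and the rank drops at each step.
  induction hr : ord.rank T (ξ (lam k).2) (hT.label hSg hne ξ (lam k)) using
    Nat.strong_induction_on generalizing k with
  | _ r ih =>
    by_cases hp : ord.Pursues (ξ (lam k).2) (hT.label hSg hne ξ (lam k))
        (hT.votes hSg hne ξ (σ k))
    · have h := IsStable.δ_of_pursues hp
      rw [← hlam k] at h
      obtain ⟨k', hk', h1, h2⟩ := ih _ (by rw [← hr, h.1]; exact h.2) (k + 1) rfl
      exact ⟨k', by omega, h1.trans h.1, h2⟩
    · exact ⟨k, le_rfl, rfl, hp⟩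

/-- On every run each formula is given up at some time at which it was to be pursued. -/
theorem IsStable.exists_not_pursues_of_index {lam : ℕ → (hT.frame hSg hne ξ).State}
    {σ : ∀ k, (hT.frame hSg hne ξ).MoveVec (lam k)}
    (hlam : ∀ k, lam (k + 1) = (hT.frame hSg hne ξ).δ (lam k) (σ k)) (i : Fin (n + 1)) :
    ∃ k, ¬ ord.Pursues (ξ i) (hT.label hSg hne ξ (lam k)) (hT.votes hSg hne ξ (σ k)) := by
  -- Each giving-up advances the index by one, so all indices modulo `n + 1` are reached.
  have h : ∀ m : ℕ, ∃ k, (lam k).2 = (lam 0).2 + (Fin.ofNat (n + 1) m) := by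
    intro m
    induction m with
    | zero => exact ⟨0, by ext; simp⟩
    | succ m ih =>
      obtain ⟨k, hk⟩ := ih
      obtain ⟨k', -, h1, h2⟩ := IsStable.exists_not_pursues hlam k
      refine ⟨k' + 1, ?_⟩
      rw [hlam, IsStable.δ_of_not_pursues h2, h1, hk, add_assoc]
      congr 1
      ext
      simp [Fin.val_add]
  obtain ⟨k, hk⟩ := h (i - (lam 0).2 : Fin (n + 1)).val
  obtain ⟨k', -, h1, h2⟩ := IsStable.exists_not_pursues hlam k
  have hi : (lam k').2 = i := by
    rw [h1, hk]
    simp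
  exact ⟨k', by rwa [hi] at h2⟩

/-- An eventuality is fulfilled on every run on which it is kept pending until then. -/
theorem IsStable.exists_fulfilled {lam : ℕ → (hT.frame hSg hne ξ).State}
    {σ : ∀ k, (hT.frame hSg hne ξ).MoveVec (lam k)}
    (hlam : ∀ k, lam (k + 1) = (hT.frame hSg hne ξ).δ (lam k) (σ k))
    {χ : Formula Ag AP} (hχ : χ ∈ Set.range ξ) (h0 : χ ∈ hT.label hSg hne ξ (lam 0))
    (hpend : ∀ k, χ ∈ hT.label hSg hne ξ (lam k) → ¬ Fulfilled χ (hT.label hSg hne ξ (lam k)) →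
      hT.votes hSg hne ξ (σ k) ∈ ord.pursuit χ (hT.label hSg hne ξ (lam k)) ∧
        χ ∈ hT.label hSg hne ξ (lam (k + 1))) :
    ∃ k, Fulfilled χ (hT.label hSg hne ξ (lam k)) ∧ ∀ j < k,
      χ ∈ hT.label hSg hne ξ (lam j) ∧ ¬ Fulfilled χ (hT.label hSg hne ξ (lam j)) := by
  classical
  have hmem : ∀ k, (∀ j < k, ¬ Fulfilled χ (hT.label hSg hne ξ (lam j))) →
      χ ∈ hT.label hSg hne ξ (lam k) := by
    intro k
    induction k with
    | zero => exact fun _ => h0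
    | succ k ih =>
      intro h
      exact (hpend k (ih fun j hj => h j (by omega)) (h k (by omega))).2
  have hex : ∃ k, Fulfilled χ (hT.label hSg hne ξ (lam k)) := by
    -- If `χ` were never fulfilled, it would persist and every move would pursue it, but it must be
    -- given up at some time.
    by_contra hn
    push Not at hn
    obtain ⟨i, rfl⟩ := hχ
    obtain ⟨k, hk⟩ := IsStable.exists_not_pursues_of_index hlam i
    have hm := hmem k fun j _ => hn j
    exact hk ⟨hm, hn k, (hpend k hm (hn k)).1⟩
  refine ⟨Nat.find hex, Nat.find_spec hex, fun j hj => ?_⟩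
  exact ⟨hmem j fun i hi => Nat.find_min hex (hi.trans hj), Nat.find_min hex hj⟩

variable (hT hSg hne ξ) in
-- The hypothesis on the label stands inside the existential so that choosing a move at every state
-- yields a total positional strategy.
theorem IsStable.exists_coalMove (A : Finset Ag) (φ : Formula Ag AP)
    (s : (hT.frame hSg hne ξ).State) :
    ∃ m : (hT.frame hSg hne ξ).CoalMove A s,
      Formula.next A φ ∈ hT.label hSg hne ξ s →
      ∀ σ : (hT.frame hSg hne ξ).MoveVec s, CGF.Extends m σ →
        hT.votes hSg hne ξ σ ∈ ord.DPos (hT.label hSg hne ξ s) A φ := by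
  by_cases h : Formula.next A φ ∈ hT.label hSg hne ξ s
  · obtain ⟨p, hp⟩ := ord.exists_vote (hT.finite_of_mem _ (IsStable.label_mem s)) h
    refine ⟨fun _ _ => p, fun _ σ hσ => hp _ (IsStable.votes_mem_D σ) fun a ha => ?_⟩
    exact congrArg Fin.val (hσ a ha)
  · exact ⟨Classical.arbitrary _, fun h' => absurd h' h⟩

variable (hT hSg hne ξ) in
theorem IsStable.exists_coMove [DecidableEq Ag] (A : Finset Ag) (φ : Formula Ag AP)
    (s : (hT.frame hSg hne ξ).State) :
    ∃ c : (hT.frame hSg hne ξ).CoMove A s,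
      Formula.neg (Formula.next A φ) ∈ hT.label hSg hne ξ s →
      ∀ m, hT.votes hSg hne ξ (c.1 m) ∈ ord.DNeg (hT.label hSg hne ξ s) A φ := by
  by_cases h : Formula.neg (Formula.next A φ) ∈ hT.label hSg hne ξ s
  · have hs := IsStable.label_mem s
    obtain ⟨c₀⟩ : Nonempty ((hT.frame hSg hne ξ).CoMove A s) := inferInstance
    by_cases hA : A = Sg
    · exact ⟨c₀, fun _ m => ⟨IsStable.votes_mem_D _, fun h => absurd hA h⟩⟩
    · have hAS : A ⊆ Sg := by
        have := hT.agents_subset _ hs _ h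
        simp only [agents, Finset.union_subset_iff] at this
        exact this.1
      have key : ∀ m : (hT.frame hSg hne ξ).CoalMove A s,
          ∃ τ : (hT.frame hSg hne ξ).MoveVec s, CGF.Extends m τ ∧
            hT.votes hSg hne ξ τ ∈ ord.DNeg (hT.label hSg hne ξ s) A φ := by
        intro m
        -- `c₀.1 m` is an arbitrary completion of `m`; only its values on `A` are kept.
        obtain ⟨τ, hτ, hτA⟩ := ord.exists_completion (hT.finite_of_mem _ hs) hA hAS h
          (IsStable.votes_mem_D (c₀.1 m))
        refine ⟨fun a => ⟨τ a, hτ.1 a⟩, fun a ha => ?_, hτ⟩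
        rw [← c₀.2 m a ha]
        exact Fin.ext (hτA a ha)
      choose c hc hc' using key
      exact ⟨⟨c, hc⟩, fun _ => hc'⟩
  · exact ⟨Classical.arbitrary _, fun h' => absurd h' h⟩

/-- The same votes serve the local and the eventuality conditions: they pass the eventuality on to
the successor and count as pursuing it, which is what `IsStable.exists_fulfilled` asks for. -/
theorem IsStable.isHintikka [DecidableEq Ag] (hξ : ∀ Δ ∈ T, Δ ⊆ Set.range ξ) :
    IsHintikka 1 (hT.frame hSg hne ξ) (hT.label hSg hne ξ) where
  H1 s φ h h' := hT.consistent _ (IsStable.label_mem s) ⟨φ, h', h⟩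
  H2 s := (hT.saturated _ (IsStable.label_mem s)).1
  H3 s := (hT.saturated _ (IsStable.label_mem s)).2
  H4 s A φ h := by
    obtain ⟨m, hm⟩ := hT.exists_coalMove hSg hne ξ A φ s
    refine ⟨m, ?_⟩
    rintro _ ⟨σ, hσ, rfl⟩
    exact (IsStable.edge_δ σ).mem_of_next h (hm h σ hσ)
  H5 s A φ h := by
    obtain ⟨c, hc⟩ := hT.exists_coMove hSg hne ξ A φ s
    refine ⟨c, ?_⟩
    rintro _ ⟨m, rfl⟩
    exact hT.neg_mem_of_edge (IsStable.label_mem s) (IsStable.edge_δ _) h (hc h m)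
  H6 s A φ ψ h := by
    choose f hf using hT.exists_coalMove hSg hne ξ A (untl A φ ψ)
    refine ⟨fun _ => f, fun lam hlam => ?_⟩
    obtain ⟨h0, hrun⟩ := CGF.mem_stratOut_one.1 hlam
    choose σ hσ hδ using hrun
    have hlater : ∀ k, untl A φ ψ ∈ hT.label hSg hne ξ (lam k) →
        ψ ∉ hT.label hSg hne ξ (lam k) → φ ∈ hT.label hSg hne ξ (lam k) ∧
          Formula.next A (untl A φ ψ) ∈ hT.label hSg hne ξ (lam k) := by
      intro k hk hψ
      have hs := hT.saturated _ (IsStable.label_mem (lam k))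
      have h1 := hs.1 _ _ _ (Alpha.neg_imp _ _)
        ((hs.2 _ _ _ (Beta.untl A φ ψ) hk).resolve_left hψ)
      exact ⟨h1.1, (hs.1 _ _ _ (Alpha.neg_neg _) h1.2).1⟩
    obtain ⟨k, hk, hj⟩ := IsStable.exists_fulfilled (χ := untl A φ ψ) (fun k => (hδ k).symm)
      (hξ _ (IsStable.label_mem s) h) (by rwa [h0]) (fun k hk hψ => by
        have hn := (hlater k hk hψ).2
        have hv := hf (lam k) hn _ (hσ k)
        refine ⟨hv, ?_⟩
        rw [← hδ k]
        exact (IsStable.edge_δ _).mem_of_next hn hv)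
    exact ⟨k, hk, fun j hjk => (hlater j (hj j hjk).1 (hj j hjk).2).1⟩
  H7 s A φ h := by
    choose c hc using hT.exists_coMove hSg hne ξ A (box A φ)
    refine ⟨fun _ => c, fun lam hlam => ?_⟩
    obtain ⟨h0, hrun⟩ := CGF.mem_coStratOut_one.1 hlam
    choose m hδ using hrun
    obtain ⟨k, hk, -⟩ := IsStable.exists_fulfilled (χ := Formula.neg (box A φ))
      (fun k => (hδ k).symm) (hξ _ (IsStable.label_mem s) h) (by rwa [h0]) (fun k hk hφ => by
        have hs := IsStable.label_mem (lam k)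
        have hn := ((hT.saturated _ hs).2 _ _ _ (Beta.neg_box A φ) hk).resolve_left hφ
        have hv := hc (lam k) hn (m k)
        refine ⟨hv, ?_⟩
        rw [← hδ k]
        exact hT.neg_mem_of_edge hs (IsStable.edge_δ _) hn hv)
    exact ⟨k, hk⟩

end Frame

end NextOrder

end Pursuit

end ATL

theorem mainTheorem2 {Ag AP : Type} [DecidableEq Ag] [Inhabited AP]
    (Sg : Finset Ag) (hSg : Sg.Nonempty)
    (θ : ATL.Formula Ag AP) (hθ : θ.agents ⊆ Sg)
    (ord : ATL.NextOrder Sg AP)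
    (T : Set (Set (ATL.Formula Ag AP)))
    (hT : ord.IsFinalTableau θ T) (hopen : ATL.TableauOpen θ T) :
    ∃ (F : ATL.CGF Sg) (H : F.State → Set (ATL.Formula Ag AP)) (s : F.State),
      Finite F.State ∧
      ATL.IsHintikka 1 F H ∧
      θ ∈ H s ∧
      (F.expand H).Sat 1 θ s ∧
      (F.expand H).Sat ⊤ θ s := by
  obtain ⟨Δ, hΔ, hm⟩ := hopen
  have hS := hT.isStable hθ
  have hfin : (⋃₀ T).Finite := hS.finite.sUnion hS.finite_of_mem
  obtain ⟨n, ξ, hξ⟩ := hfin.fin_embedding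
  -- All formulae of the tableau are enumerated. The index of `θ` shows that the enumeration is
  -- non-empty, as the cyclic shift requires; as a starting index it is an arbitrary choice.
  obtain ⟨i, -⟩ : θ ∈ Set.range ξ := hξ ▸ ⟨Δ, hΔ, hm⟩
  obtain ⟨n, rfl⟩ := Nat.exists_eq_add_of_le' i.pos
  have hH := ATL.NextOrder.IsStable.isHintikka (hT := hS) (hSg := hSg) (hne := ⟨Δ, hΔ⟩) (ξ := ξ)
    fun Δ' hΔ' => hξ ▸ Set.subset_sUnion_of_mem hΔ'
  have : Finite T := hS.finite
  exact ⟨hS.frame hSg ⟨Δ, hΔ⟩ ξ, hS.label hSg ⟨Δ, hΔ⟩ ξ, (⟨Δ, hΔ⟩, i),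
    inferInstanceAs (Finite (T × Fin (n + 1))), hH, hm,
    (hH.truth 1 θ _).1 hm, (hH.truth ⊤ θ _).1 hm⟩
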